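/- Let $abcd$ be a regular tetrahedron in $\mathbb{R}^3$ with sides of length $2$. **Definitions.** A *parabolic pea pod* $\Sigma$ with beam $ab$ is given by a point $c_\Sigma$ that is equidistant from $a$ and $b$ and is not on the line $ab$. Let $H_\Sigma$ be the plane through $a,b,c_\Sigma$, let $r_\Sigma=|c_\Sigma a|$, let the *principal circle* be the circle in $H_\Sigma$ with center $c_\Sigma$ and radius $r_\Sigma$, and let the *axis* be the line through $c_\Sigma$ and the midpoint of $ab$. Let $E(\Sigma)$ be the set of the centers $x$ of the disks in $H_\Sigma$ (of radius $R(x)\ge 0$) that lie inside the principal circle, are tangent to it and to the line $ab$, and lie in the half plane of $H_\Sigma$ bounded by the line $ab$ opposite to $c_\Sigma$. These centers lie on a parabola in $H_\Sigma$ with focus $c_\Sigma$, the *pea string* $C_\Sigma$, whose directrix is the line parallel to $ab$ at distance $r_\Sigma$ from it on the side opposite to $c_\Sigma$. Two such pea pods $\Sigma_1,\Sigma_2$ are *confocal* if they have the same axis, their planes are orthogonal, and each of the parabolas $C_{\Sigma_1},C_{\Sigma_2}$ contains the focus of the other; they are *convex confocal* if moreover $c_{\Sigma_1}$ is the point of $E(\Sigma_2)$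 on the axis and $c_{\Sigma_2}$ is the point of $E(\Sigma_1)$ on the axis. For points $x\ne y$ let $\varphi_\Sigma(x,y)$ be the point of the line $xy$ at distance $R(x)$ from $x$ for which $x$ is between it and $y$. Choose convex confocal parabolic pea pods on each of the three pairs of opposite edges of $abcd$. For a chosen confocal pair $\Sigma_1,\Sigma_2$ with beams $ab,cd$, the *wedge-pod surfaces* are $(AB)=\{\varphi_{\Sigma_1}(x,y): x\in E(\Sigma_1),\,y\in E(\Sigma_2)\}$ and $(CD)=\{\varphi_{\Sigma_2}(y,x): x\in E(\Sigma_1),\,y\in E(\Sigma_2)\}$, and the surfaces $(AC),(BD),(AD),(BC)$ are defined in the same way. For a vertex $v$ and the pea pod $\Sigma$ of an edge $e$ not containing $v$, the points $\varphi_{\Sigma}(x,v)$, $x\in E(\Sigma)$, form a curve on the sphere $\mathbb S(v,2)$ that joins the ends of $e$. For each $v$ let the *cap* of $v$ be the part of $\mathbb S(v,2)$ that is bounded by the union of the three such curves and is contained in the boundary of the Reuleaux tetrahedron (the intersection of the four balls of radius $2$ with centers $a,b,c,d$). Let $\Im$ be the union of the six wedge-pod surfaces and the four caps. *Robert's body*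 $\mathcal R$ is the body $\operatorname{conv}(\Im)$. **Statement.** 1. There is exactly one pair of convex confocal parabolic pea pods with beams $ab$ and $cd$ (and hence, by relabelling, on each pair of opposite edges). 2. Consequently Robert's body $\mathcal R$ of $abcd$ exists and is unique. 3. $\mathcal R$ has the full symmetry group of the regular tetrahedron $abcd$: an isometry $g$ of $\mathbb{R}^3$ satisfies $g(\mathcal R)=\mathcal R$ if and only if it maps the tetrahedron $abcd$ onto itself. -/

import Mathlib

noncomputable section

namespace Peabody

/-- Euclidean three-space. -/
abbrev E3 : Type := EuclideanSpace ℝ (Fin 3)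

/-- The parabola in the plane `H` with focus `F` and directrix `D`. -/
def parabola (H : AffineSubspace ℝ E3) (F : E3) (D : AffineSubspace ℝ E3) : Set E3 :=
  {x | x ∈ H ∧ dist x F = Metric.infDist x (D : Set E3)}

/-- A parabolic pea pod frame with longitudinal beam `ab`: one of its two circles is the line
through `ab`, and the other one, the principal circle, has `ab` as a chord, so that it is given by
its center.  The center is not on the beam, as there has to be a half plane opposite to it. -/
@[ext]
structure ParabolicPeaPod (a b : E3) where
  center : E3
  ends_ne : a ≠ b
  dist_ends : dist center a = dist center b
  center_ne : center ≠ midpoint ℝ a b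

namespace ParabolicPeaPod

variable {a b : E3}

/-- The radius of the principal circle. -/
def radius (S : ParabolicPeaPod a b) : ℝ := dist S.center a

/-- The plane of the frame. -/
def plane (S : ParabolicPeaPod a b) : AffineSubspace ℝ E3 := affineSpan ℝ {a, b, S.center}

/-- The axis: the line through the center of the principal circle that is perpendicular to the
beam and meets it in its midpoint. -/
def axis (S : ParabolicPeaPod a b) : AffineSubspace ℝ E3 :=
  affineSpan ℝ {S.center, midpoint ℝ a b}

/-- The line that contains the beam. -/
def beamLine (_S : ParabolicPeaPod a b) : AffineSubspace ℝ E3 := affineSpan ℝ {a, b}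

/-- The radius of a disk of the frame's plane with center `x` that is tangent to the beam. -/
def peaRadius (S : ParabolicPeaPod a b) (x : E3) : ℝ := Metric.infDist x (S.beamLine : Set E3)

/-- The set of the centers of the disks (those of radius zero included) in the plane of the frame
that lie inside the principal circle, are tangent to it and to the beam, and are in the half plane
opposite to the center of the principal circle. -/
def arc (S : ParabolicPeaPod a b) : Set E3 :=
  {x | x ∈ S.plane ∧ S.beamLine.WOppSide S.center x ∧
    dist x S.center + S.peaRadius x = S.radius}

/-- The parallel to the beam at distance `radius` from it, on the side opposite to `center`. -/
def directrix (S : ParabolicPeaPod a b) : AffineSubspace ℝ E3 :=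
  AffineSubspace.mk'
    (midpoint ℝ a b +
      (S.radius / dist (midpoint ℝ a b) S.center) • (midpoint ℝ a b - S.center))
    S.beamLine.direction

/-- The parabolic pea string: the parabola, with focus at the center of the principal circle, on
which the centers of the disks lie. -/
def peaString (S : ParabolicPeaPod a b) : Set E3 := parabola S.plane S.center S.directrix

/-- `x` is the center of the bulb: the pea whose center lies on the axis. -/
def IsBulbCenter (S : ParabolicPeaPod a b) (x : E3) : Prop := x ∈ S.arc ∧ x ∈ S.axis

/-- The point of the line through `x` and `y` at distance `peaRadius x` from `x` for which `x` is
between it and `y`. -/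
def outer (S : ParabolicPeaPod a b) (x y : E3) : E3 := x + (S.peaRadius x / dist x y) • (x - y)

/-- The curve `{φ(x, v) : x ∈ E(S)}` from `a` to `b` determined by the vertex `v`. -/
def edgeCurve (S : ParabolicPeaPod a b) (v : E3) : Set E3 := (fun x => S.outer x v) '' S.arc

end ParabolicPeaPod

variable {a b c d : E3}

/-- Confocal pea pods: the axes agree, the planes are orthogonal (their normals are), and the pea
strings are confocal, that is, each of the two parabolas contains the focus of the other. -/
structure IsConfocal (S : ParabolicPeaPod a b) (T : ParabolicPeaPod c d) : Prop where
  axis_eq : S.axis = T.axis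
  planes_orthogonal : S.plane.directionᗮ ⟂ T.plane.directionᗮ
  left_focus_mem : S.center ∈ T.peaString
  right_focus_mem : T.center ∈ S.peaString

/-- Convex confocal pea pods: moreover, the center of the principal circle of each of them is the
center of the bulb of the other. -/
structure IsConvexConfocal (S : ParabolicPeaPod a b) (T : ParabolicPeaPod c d) : Prop
    extends IsConfocal S T where
  left_center_bulb : T.IsBulbCenter S.center
  right_center_bulb : S.IsBulbCenter T.center

/-- The wedge-pod surface of `S` in the confocal pair `S`, `T`; the other wedge-pod surface of the
pair is `wedgePod T S`. -/
def wedgePod (S : ParabolicPeaPod a b) (T : ParabolicPeaPod c d) : Set E3 :=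
  Set.image2 S.outer S.arc T.arc

/-- A regular tetrahedron with sides of length `2`. -/
structure IsRegularTetrahedron (a b c d : E3) : Prop where
  ab : dist a b = 2
  ac : dist a c = 2
  ad : dist a d = 2
  bc : dist b c = 2
  bd : dist b d = 2
  cd : dist c d = 2

/-- The solid tetrahedron. -/
def tetrahedron (a b c d : E3) : Set E3 := convexHull ℝ {a, b, c, d}

/-- The Reuleaux tetrahedron over a regular tetrahedron with sides of length `2`. -/
def reuleaux (a b c d : E3) : Set E3 :=
  Metric.closedBall a 2 ∩ Metric.closedBall b 2 ∩ Metric.closedBall c 2 ∩ Metric.closedBall d 2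

/-- The cap of the sphere with center `v` and radius `2` that is bounded by the closed curve `Γ`
and is contained in the boundary of `T`: the curve together with what it bounds in `∂T`. -/
def cap (T : Set E3) (v : E3) (Γ : Set E3) : Set E3 :=
  Γ ∪ {p | p ∈ Metric.sphere v 2 \ Γ ∧
    connectedComponentIn (Metric.sphere v 2 \ Γ) p ⊆ frontier T}

/-- A choice of convex confocal pea pods with parabolic pea strings on each of the three pairs of
opposite edges of the tetrahedron `abcd`. -/
structure ParabolicDevices (a b c d : E3) where
  ab : ParabolicPeaPod a b
  cd : ParabolicPeaPod c d
  ac : ParabolicPeaPod a c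
  bd : ParabolicPeaPod b d
  ad : ParabolicPeaPod a d
  bc : ParabolicPeaPod b c
  ab_cd : IsConvexConfocal ab cd
  ac_bd : IsConvexConfocal ac bd
  ad_bc : IsConvexConfocal ad bc

namespace ParabolicDevices

/-- The union of the six wedge-pod surfaces. -/
def wedges (P : ParabolicDevices a b c d) : Set E3 :=
  wedgePod P.ab P.cd ∪ wedgePod P.cd P.ab ∪ wedgePod P.ac P.bd ∪ wedgePod P.bd P.ac ∪
    wedgePod P.ad P.bc ∪ wedgePod P.bc P.ad

/-- The union of the four spherical caps. -/
def caps (P : ParabolicDevices a b c d) : Set E3 :=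
  cap (reuleaux a b c d) a (P.bc.edgeCurve a ∪ P.cd.edgeCurve a ∪ P.bd.edgeCurve a) ∪
  cap (reuleaux a b c d) b (P.cd.edgeCurve b ∪ P.ad.edgeCurve b ∪ P.ac.edgeCurve b) ∪
  cap (reuleaux a b c d) c (P.ab.edgeCurve c ∪ P.bd.edgeCurve c ∪ P.ad.edgeCurve c) ∪
  cap (reuleaux a b c d) d (P.ab.edgeCurve d ∪ P.bc.edgeCurve d ∪ P.ac.edgeCurve d)

/-- The closed surface assembled from the wedge-pod surfaces and the spherical caps. -/
def surface (P : ParabolicDevices a b c d) : Set E3 := P.wedges ∪ P.caps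

end ParabolicDevices

/-- `R` is the body assembled over `abcd` from parabolic pea pods: the convex hull of the assembled
surface. -/
def IsRobertsBody (a b c d : E3) (R : Set E3) : Prop :=
  ∃ P : ParabolicDevices a b c d, R = convexHull ℝ P.surface

end Peabody

end

/-!
Let `r` be the radius of the principal circle of a pod and `u` the distance of its center from the
beam. That each center is the bulb center of the other pod makes the two axis directions opposite
and turns confocality into linear equations for `u` and `r`; with
`r ^ 2 = u ^ 2 + (dist a b / 2) ^ 2` these have a single admissible solution. So the body is
canonical, and an isometry that permutes the vertices preserves it.

Conversely, the body lies in the ball circumscribed about `abcd` and meets the circumscribed sphere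
in the four vertices only. No other ball of that radius contains the vertices, because the
circumcenter is in their convex hull. Hence an isometry that preserves the body fixes the
circumcenter and permutes the vertices.
-/

noncomputable section

namespace Peabody

open Metric Set Module
open scoped RealInnerProductSpace

/-! ### Convex hulls, spheres and regular simplices -/

section ConvexHull

variable {E : Type*} [NormedAddCommGroup E]

theorem convexHull_inter_sphere_subset [NormedSpace ℝ E] [StrictConvexSpace ℝ E] {s : Set E}
    {o : E} {r : ℝ} (hr : r ≠ 0) (hs : s ⊆ closedBall o r) : convexHull ℝ s ∩ sphere o r ⊆ s :=
  fun _ hx => extremePoints_convexHull_subset <|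
    inter_extremePoints_subset_extremePoints_of_subset
      (convexHull_min hs (convex_closedBall o r))
      ⟨hx.1, StrictConvexSpace.sphere_subset_extremePoints_closedBall o hr hx.2⟩

variable [InnerProductSpace ℝ E]

theorem eq_of_mem_convexHull_of_subset_sphere {s : Set E} {o p : E} {r : ℝ}
    (ho : o ∈ convexHull ℝ s) (hs : s ⊆ sphere o r) (hp : s ⊆ closedBall p r) : p = o := by
  have halfSpace : s ⊆ {x | ⟪o - p, x⟫ ≤ ⟪o - p, o⟫ - ‖o - p‖ ^ 2 / 2} := fun x hx => by
    have hxo := mem_sphere_iff_norm.1 (hs hx)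
    have hxp := pow_le_pow_left₀ (norm_nonneg _) (mem_closedBall_iff_norm.1 (hp hx)) 2
    rw [← sub_add_sub_cancel x o p, norm_add_sq_real, hxo, real_inner_comm, inner_sub_right] at hxp
    change ⟪o - p, x⟫ ≤ ⟪o - p, o⟫ - ‖o - p‖ ^ 2 / 2
    linarith
  have hle : ⟪o - p, o⟫ ≤ ⟪o - p, o⟫ - ‖o - p‖ ^ 2 / 2 :=
    convexHull_min halfSpace (convex_halfSpace_le (innerₗ E (o - p)).isLinear _) ho
  have hsq : ‖o - p‖ ^ 2 = 0 := le_antisymm (by linarith) (sq_nonneg _)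
  exact (sub_eq_zero.1 (norm_eq_zero.1 (pow_eq_zero_iff two_ne_zero |>.1 hsq))).symm

theorem image_eq_of_image_convexHull_eq {s t : Set E} {o : E} {r : ℝ} (hr : r ≠ 0)
    (ho : o ∈ convexHull ℝ t) (ht : t ⊆ sphere o r) (hts : t ⊆ s) (hs : s ⊆ ball o r ∪ t)
    (g : E ≃ᵢ E) (hg : g '' convexHull ℝ s = convexHull ℝ s) : g '' t = t := by
  have hsb : s ⊆ closedBall o r :=
    hs.trans (union_subset ball_subset_closedBall (ht.trans sphere_subset_closedBall))
  have hull_inter : convexHull ℝ s ∩ sphere o r = t := by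
    refine Subset.antisymm (fun x hx => ?_)
      fun x hx => ⟨subset_convexHull ℝ s (hts hx), ht hx⟩
    refine (hs (convexHull_inter_sphere_subset hr hsb hx)).resolve_left fun hxb => ?_
    exact (mem_ball.1 hxb).ne hx.2
  have center_eq : g o = o := by
    refine eq_of_mem_convexHull_of_subset_sphere ho ht fun x hx => ?_
    have hgx : x ∈ g '' closedBall o r := by
      rw [← hull_inter, ← hg] at hx
      exact image_mono (convexHull_min hsb (convex_closedBall o r)) hx.1
    rwa [g.image_closedBall] at hgx
  nth_rw 1 [← hull_inter]
  rw [image_inter g.injective, hg, g.image_sphere, center_eq, hull_inter]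

end ConvexHull

section RegularSimplex

theorem sum_mul_dist_sq_of_pairwise_dist_eq {P ι : Type*} [PseudoMetricSpace P] [Fintype ι]
    {v : ι → P} {r : ℝ} (hv : Pairwise fun i j => dist (v i) (v j) = r) (w : ι → ℝ) (i : ι) :
    ∑ j, w j * dist (v i) (v j) ^ 2 = ((∑ j, w j) - w i) * r ^ 2 := by
  classical
  calc
    ∑ j, w j * dist (v i) (v j) ^ 2 = ∑ j ∈ Finset.univ.erase i, w j * r ^ 2 := by
      rw [← Finset.sum_erase Finset.univ (a := i) (by simp)]
      exact Finset.sum_congr rfl fun j hj => by rw [hv (Finset.ne_of_mem_erase hj).symm]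
    _ = ((∑ j, w j) - w i) * r ^ 2 := by
      rw [← Finset.sum_mul, Finset.sum_erase_eq_sub (Finset.mem_univ i)]

variable {E ι : Type*} [NormedAddCommGroup E] [InnerProductSpace ℝ E]

theorem sum_mul_dist_sq_sub_sum_mul_dist_sq [Fintype ι] (w : ι → ℝ) (v : ι → E) (x y : E) :
    ∑ i, w i * dist x (v i) ^ 2 - ∑ i, w i * dist y (v i) ^ 2 =
      ⟪x - y, (∑ i, w i) • (x + y) - (2 : ℝ) • ∑ i, w i • v i⟫ := by
  rw [inner_sub_right, inner_smul_right, inner_smul_right, inner_sum, Finset.sum_mul,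
    Finset.mul_sum, ← Finset.sum_sub_distrib, ← Finset.sum_sub_distrib]
  refine Finset.sum_congr rfl fun i _ => ?_
  rw [dist_eq_norm, dist_eq_norm, norm_sub_sq_real, norm_sub_sq_real, inner_smul_right,
    inner_sub_left, inner_sub_left, inner_add_right, inner_add_right, real_inner_self_eq_norm_sq,
    real_inner_self_eq_norm_sq, real_inner_comm x y]
  ring

variable {v : ι → E} {r : ℝ} (hv : Pairwise fun i j => dist (v i) (v j) = r)
include hv

theorem affineIndependent_of_pairwise_dist_eq [Finite ι] (hr : r ≠ 0) :
    AffineIndependent ℝ v := by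
  cases nonempty_fintype ι
  refine (affineIndependent_iff_of_fintype ℝ v).2 fun w hw hwv i => ?_
  rw [Finset.weightedVSub_eq_linear_combination _ hw] at hwv
  have weights_eq (j : ι) : w j = w i := by
    have h := sum_mul_dist_sq_sub_sum_mul_dist_sq w v (v i) (v j)
    rw [hwv, hw, zero_smul, smul_zero, sub_zero, inner_zero_right,
      sum_mul_dist_sq_of_pairwise_dist_eq hv, sum_mul_dist_sq_of_pairwise_dist_eq hv, hw] at h
    refine mul_right_cancel₀ (pow_ne_zero 2 hr) ?_
    linarith
  rw [Finset.sum_congr rfl fun j _ => weights_eq j, Finset.sum_const, Finset.card_univ,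
    nsmul_eq_mul] at hw
  have : Nonempty ι := ⟨i⟩
  exact (mul_eq_zero.1 hw).resolve_left (Nat.cast_ne_zero.2 Fintype.card_ne_zero)

theorem mem_convexHull_of_pairwise_dist_eq [Fintype ι] [FiniteDimensional ℝ E] (hr : 0 < r)
    (hcard : Fintype.card ι = finrank ℝ E + 1) {o x : E} {R : ℝ}
    (ho : ∀ i, dist o (v i) = R) (hx : ∀ i, dist x (v i) ≤ r) (hR : R ≤ dist x o) :
    x ∈ convexHull ℝ (range v) := by
  have hind := affineIndependent_of_pairwise_dist_eq hv hr.ne'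
  let b : AffineBasis ι ℝ E := ⟨v, hind, hind.affineSpan_eq_top_iff_card_eq_finrank_add_one.2 hcard⟩
  have hbx : ∑ i, b.coord i x • v i = x := b.linear_combination_coord_eq_self x
  have hb1 : ∑ i, b.coord i x = 1 := b.sum_coord_apply_eq_one x
  have leibniz (y : E) : ∑ i, b.coord i x * dist y (v i) ^ 2 =
      dist y x ^ 2 + ∑ i, b.coord i x * dist x (v i) ^ 2 := by
    rw [← sub_eq_iff_eq_add, sum_mul_dist_sq_sub_sum_mul_dist_sq, hbx, hb1, one_smul, two_smul,
      add_sub_add_right_eq_sub, real_inner_self_eq_norm_sq, dist_eq_norm]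
  change x ∈ convexHull ℝ (range b)
  rw [b.convexHull_eq_nonneg_coord]
  intro i
  have hi := leibniz (v i)
  have hcenter := leibniz o
  simp only [ho, ← Finset.sum_mul, hb1, one_mul] at hcenter
  rw [sum_mul_dist_sq_of_pairwise_dist_eq hv, hb1] at hi
  have h1 := pow_le_pow_left₀ dist_nonneg (hx i) 2
  have h2 := pow_le_pow_left₀ (ho i ▸ dist_nonneg) hR 2
  rw [dist_comm] at h1 h2
  have : 0 ≤ b.coord i x * r ^ 2 := by linarith
  exact nonneg_of_mul_nonneg_left this (by positivity)

theorem mem_ball_union_range_of_pairwise_dist_eq [Fintype ι] [FiniteDimensional ℝ E] (hr : 0 < r)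
    (hcard : Fintype.card ι = finrank ℝ E + 1) {o x : E} {R : ℝ} (hR : R ≠ 0)
    (ho : ∀ i, dist o (v i) = R) (hx : ∀ i, dist x (v i) ≤ r) : x ∈ ball o R ∪ range v := by
  refine or_iff_not_imp_left.2 fun hxo => ?_
  have hRx : R ≤ dist x o := not_lt.1 hxo
  have hvo : range v ⊆ closedBall o R :=
    range_subset_iff.2 fun i => mem_closedBall'.2 (ho i).le
  have hx_hull := mem_convexHull_of_pairwise_dist_eq hv hr hcard ho hx hRx
  exact convexHull_inter_sphere_subset hR hvo
    ⟨hx_hull, (convexHull_min hvo (convex_closedBall o R) hx_hull).antisymm hRx⟩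

end RegularSimplex

section Orthogonal

variable {V P : Type*} [NormedAddCommGroup V] [InnerProductSpace ℝ V]

theorem infDist_vadd_of_mem_orthogonal_direction [MetricSpace P] [NormedAddTorsor V P]
    {s : AffineSubspace ℝ P} [s.direction.HasOrthogonalProjection] {p : P} {v : V} (hp : p ∈ s)
    (hv : v ∈ s.directionᗮ) : infDist (v +ᵥ p) (s : Set P) = ‖v‖ := by
  have : Nonempty s := ⟨p, hp⟩
  rw [← EuclideanGeometry.dist_orthogonalProjection_eq_infDist,
    EuclideanGeometry.orthogonalProjection_vadd_eq_self hp hv, dist_eq_norm_vsub V,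
    vadd_vsub]

theorem mem_span_singleton_of_inner_eq_zero {ι : Type*} [Fintype ι] {v : ι → V}
    (hv₀ : ∀ i, v i ≠ 0) (hv : Pairwise fun i j => ⟪v i, v j⟫ = 0)
    (hcard : Fintype.card ι = finrank ℝ V) {i : ι} {w : V} (hw : ∀ j ≠ i, ⟪v j, w⟫ = 0) :
    w ∈ ℝ ∙ v i := by
  have hind : LinearIndependent ℝ v := linearIndependent_of_ne_zero_of_inner_eq_zero hv₀ hv
  have : Nonempty ι := ⟨i⟩
  let b := basisOfLinearIndependentOfCardEqFinrank hind hcard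
  have hb : ⇑b = v := coe_basisOfLinearIndependentOfCardEqFinrank hind hcard
  refine Submodule.mem_span_singleton.2 ⟨⟪v i, w⟫ / ‖v i‖ ^ 2, ?_⟩
  refine InnerProductSpace.ext_inner_left_basis b fun j => ?_
  rw [hb, inner_smul_right]
  obtain rfl | hji := eq_or_ne j i
  · rw [real_inner_self_eq_norm_sq, div_mul_cancel₀ _ (by simpa using hv₀ j)]
  · rw [hw j hji, hv hji, mul_zero]

end Orthogonal

/-! ### Parabolic pea pods in coordinates -/

namespace ParabolicPeaPod

variable {a b : E3} (S : ParabolicPeaPod a b)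

/-- The distance from the center of the principal circle to the beam, which is its chord. -/
def apothem : ℝ := dist S.center (midpoint ℝ a b)

/-- The unit vector along the axis that points from the center of the principal circle to the
beam. Together with points of the beam's line it provides coordinates `t • S.axisDir + p` on the
plane of the frame, in which `t` is the signed distance to the beam. -/
def axisDir : E3 := S.apothem⁻¹ • (midpoint ℝ a b - S.center)

theorem apothem_pos : 0 < S.apothem := dist_pos.2 S.center_ne

theorem apothem_smul_axisDir : S.apothem • S.axisDir = midpoint ℝ a b - S.center :=
  smul_inv_smul₀ S.apothem_pos.ne' _

theorem norm_axisDir : ‖S.axisDir‖ = 1 := by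
  rw [axisDir, norm_smul, ← dist_eq_norm, dist_comm, ← apothem, norm_inv,
    Real.norm_of_nonneg S.apothem_pos.le, inv_mul_cancel₀ S.apothem_pos.ne']

theorem center_eq : S.center = -S.apothem • S.axisDir + midpoint ℝ a b := by
  rw [neg_smul, apothem_smul_axisDir, neg_sub, sub_add_cancel]

theorem radius_nonneg : 0 ≤ S.radius := dist_nonneg

theorem smul_center_vsub_midpoint_vadd (k : ℝ) (p : E3) :
    k • (S.center -ᵥ midpoint ℝ a b) +ᵥ p = -(k * S.apothem) • S.axisDir + p := by
  rw [vsub_eq_sub, vadd_eq_add, ← neg_sub, ← S.apothem_smul_axisDir]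
  module

theorem left_mem_beamLine : a ∈ S.beamLine := left_mem_affineSpan_pair ℝ a b

theorem right_mem_beamLine : b ∈ S.beamLine := right_mem_affineSpan_pair ℝ a b

theorem midpoint_mem_beamLine : midpoint ℝ a b ∈ S.beamLine :=
  AffineMap.lineMap_mem_affineSpan_pair _ a b

theorem axisDir_mem_orthogonal : S.axisDir ∈ S.beamLine.directionᗮ := by
  have hperp := AffineSubspace.mem_perpBisector_iff_inner_eq_zero.1
    (AffineSubspace.mem_perpBisector_iff_dist_eq.2 S.dist_ends)
  refine (Submodule.mem_orthogonal' _ _).2 fun w hw => ?_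
  rw [beamLine, direction_affineSpan, mem_vectorSpan_pair_rev] at hw
  obtain ⟨k, rfl⟩ := hw
  rw [axisDir, inner_smul_left, inner_smul_right, ← neg_sub, inner_neg_left]
  rw [vsub_eq_sub] at hperp
  rw [hperp, neg_zero, mul_zero, mul_zero]

theorem inner_sub_axisDir : ⟪b - a, S.axisDir⟫ = 0 :=
  S.axisDir_mem_orthogonal _
    (AffineSubspace.vsub_mem_direction S.right_mem_beamLine S.left_mem_beamLine)

theorem beamLine_le_plane : S.beamLine ≤ S.plane :=
  affineSpan_mono ℝ (by grind)

theorem sub_mem_direction_plane : b - a ∈ S.plane.direction :=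
  AffineSubspace.vsub_mem_direction (S.beamLine_le_plane S.right_mem_beamLine)
    (S.beamLine_le_plane S.left_mem_beamLine)

theorem axisDir_mem_direction_plane : S.axisDir ∈ S.plane.direction :=
  Submodule.smul_mem _ _ (AffineSubspace.vsub_mem_direction
    (S.beamLine_le_plane S.midpoint_mem_beamLine) (mem_affineSpan ℝ (by simp)))

variable {S} {x p q : E3} {s t : ℝ}

theorem dist_sq_smul_axisDir_add (hp : p ∈ S.beamLine) (hq : q ∈ S.beamLine) (s t : ℝ) :
    dist (s • S.axisDir + p) (t • S.axisDir + q) ^ 2 = dist p q ^ 2 + (s - t) ^ 2 := by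
  rw [sq, ← vadd_eq_add, ← vadd_eq_add,
    EuclideanGeometry.dist_sq_smul_orthogonal_vadd_smul_orthogonal_vadd hp hq s t
      S.axisDir_mem_orthogonal, S.norm_axisDir, mul_one, mul_one, ← sq, ← sq, Real.norm_eq_abs,
    sq_abs]

theorem dist_smul_axisDir_add_center_sq (hp : p ∈ S.beamLine) (t : ℝ) :
    dist (t • S.axisDir + p) S.center ^ 2 =
      dist p (midpoint ℝ a b) ^ 2 + (t + S.apothem) ^ 2 := by
  rw [center_eq, dist_sq_smul_axisDir_add hp S.midpoint_mem_beamLine, sub_neg_eq_add]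

theorem peaRadius_smul_axisDir_add (hp : p ∈ S.beamLine) (t : ℝ) :
    S.peaRadius (t • S.axisDir + p) = |t| := by
  rw [peaRadius, ← vadd_eq_add, infDist_vadd_of_mem_orthogonal_direction hp
    (Submodule.smul_mem _ t S.axisDir_mem_orthogonal), norm_smul, S.norm_axisDir, mul_one,
    Real.norm_eq_abs]

variable (S) in
theorem radius_sq : S.radius ^ 2 = (dist a b / 2) ^ 2 + S.apothem ^ 2 := by
  have h := dist_smul_axisDir_add_center_sq S.left_mem_beamLine 0
  rw [zero_smul, zero_add, zero_add, dist_comm, dist_left_midpoint, Real.norm_ofNat] at h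
  rw [radius, h]
  ring

variable (S) in
theorem apothem_lt_radius : S.apothem < S.radius := by
  refine lt_of_pow_lt_pow_left₀ 2 S.radius_nonneg ?_
  rw [S.radius_sq]
  exact lt_add_of_pos_left _ (pow_pos (half_pos (dist_pos.2 S.ends_ne)) 2)

theorem mem_plane_iff : x ∈ S.plane ↔ ∃ p ∈ S.beamLine, ∃ t : ℝ, x = t • S.axisDir + p := by
  have hplane : S.plane = affineSpan ℝ (insert S.center (S.beamLine : Set E3)) := by
    rw [plane, beamLine, affineSpan_insert_affineSpan]
    congr 1
    grind
  rw [hplane, AffineSubspace.mem_affineSpan_insert_iff S.midpoint_mem_beamLine]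
  constructor
  · rintro ⟨k, p, hp, rfl⟩
    exact ⟨p, hp, _, S.smul_center_vsub_midpoint_vadd k p⟩
  · rintro ⟨p, hp, t, rfl⟩
    refine ⟨-t / S.apothem, p, hp, ?_⟩
    rw [S.smul_center_vsub_midpoint_vadd, div_mul_cancel₀ _ S.apothem_pos.ne', neg_neg]

theorem mem_axis_iff : x ∈ S.axis ↔ ∃ t : ℝ, x = t • S.axisDir + midpoint ℝ a b := by
  rw [axis, Set.pair_comm, mem_affineSpan_pair_iff_exists_lineMap_eq]
  simp only [AffineMap.lineMap_apply, S.smul_center_vsub_midpoint_vadd]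
  constructor
  · rintro ⟨k, rfl⟩
    exact ⟨_, rfl⟩
  · rintro ⟨t, rfl⟩
    exact ⟨-t / S.apothem, by rw [div_mul_cancel₀ _ S.apothem_pos.ne', neg_neg]⟩

variable (S) in
theorem center_notMem_beamLine : S.center ∉ S.beamLine := fun h => by
  have h0 := peaRadius_smul_axisDir_add S.midpoint_mem_beamLine (-S.apothem)
  rw [← center_eq, peaRadius, infDist_zero_of_mem h, abs_neg] at h0
  exact (abs_pos.2 S.apothem_pos.ne').ne h0

theorem wOppSide_smul_axisDir_add_iff (hp : p ∈ S.beamLine) :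
    S.beamLine.WOppSide S.center (t • S.axisDir + p) ↔ 0 ≤ t := by
  have hvadd : t • S.axisDir + p =
      (-t / S.apothem) • (S.center -ᵥ midpoint ℝ a b) +ᵥ p := by
    rw [S.smul_center_vsub_midpoint_vadd, div_mul_cancel₀ _ S.apothem_pos.ne', neg_neg]
  rw [hvadd]
  refine ⟨fun h => ?_, fun ht => ?_⟩
  · by_contra! ht
    exact (AffineSubspace.sSameSide_smul_vsub_vadd_right S.center_notMem_beamLine
      S.midpoint_mem_beamLine hp (div_pos (neg_pos.2 ht) S.apothem_pos)).not_wOppSide h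
  · exact AffineSubspace.wOppSide_smul_vsub_vadd_right _ S.midpoint_mem_beamLine hp
      (div_nonpos_of_nonpos_of_nonneg (neg_nonpos.2 ht) S.apothem_pos.le)

theorem smul_axisDir_add_mem_arc_iff (hp : p ∈ S.beamLine) :
    t • S.axisDir + p ∈ S.arc ↔ 0 ≤ t ∧
      dist p (midpoint ℝ a b) ^ 2 = (dist a b / 2) ^ 2 - 2 * t * (S.radius + S.apothem) := by
  have hdist := dist_smul_axisDir_add_center_sq hp t
  have hr := S.radius_sq
  have hr0 := S.radius_nonneg
  have hu := S.apothem_pos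
  have hplane : t • S.axisDir + p ∈ S.plane := mem_plane_iff.2 ⟨p, hp, t, rfl⟩
  rw [arc, Set.mem_ofPred_eq, wOppSide_smul_axisDir_add_iff hp, peaRadius_smul_axisDir_add hp]
  simp only [hplane, true_and]
  refine and_congr_right fun ht => ?_
  rw [abs_of_nonneg ht, ← eq_sub_iff_add_eq]
  constructor
  · intro h
    rw [h] at hdist
    linarith
  · intro h
    have ht_le : t ≤ S.radius := by nlinarith [sq_nonneg (dist p (midpoint ℝ a b))]
    refine (sq_eq_sq₀ dist_nonneg (sub_nonneg.2 ht_le)).1 ?_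
    linarith

theorem mem_arc_iff : x ∈ S.arc ↔ ∃ p ∈ S.beamLine, ∃ t : ℝ, x = t • S.axisDir + p ∧ 0 ≤ t ∧
    dist p (midpoint ℝ a b) ^ 2 = (dist a b / 2) ^ 2 - 2 * t * (S.radius + S.apothem) := by
  constructor
  · intro hx
    obtain ⟨p, hp, t, rfl⟩ := mem_plane_iff.1 hx.1
    exact ⟨p, hp, t, rfl, (smul_axisDir_add_mem_arc_iff hp).1 hx⟩
  · rintro ⟨p, hp, t, rfl, h⟩
    exact (smul_axisDir_add_mem_arc_iff hp).2 h

theorem isBulbCenter_iff : S.IsBulbCenter x ↔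
    x = ((S.radius - S.apothem) / 2) • S.axisDir + midpoint ℝ a b := by
  have hu := S.apothem_pos
  have hur := S.apothem_lt_radius
  have hr := S.radius_sq
  have mem_arc_iff_eq (t : ℝ) : t • S.axisDir + midpoint ℝ a b ∈ S.arc ↔
      t = (S.radius - S.apothem) / 2 := by
    rw [smul_axisDir_add_mem_arc_iff S.midpoint_mem_beamLine, dist_self]
    constructor
    · rintro ⟨-, h⟩
      have hprod : (t - (S.radius - S.apothem) / 2) * (S.radius + S.apothem) = 0 := by linarith
      exact sub_eq_zero.1 ((mul_eq_zero.1 hprod).resolve_right (by linarith))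
    · rintro rfl
      exact ⟨by linarith, by linarith⟩
  constructor
  · rintro ⟨harc, haxis⟩
    obtain ⟨t, rfl⟩ := mem_axis_iff.1 haxis
    rw [(mem_arc_iff_eq t).1 harc]
  · rintro rfl
    exact ⟨(mem_arc_iff_eq _).2 rfl, mem_axis_iff.2 ⟨_, rfl⟩⟩

theorem arc_subset_peaString : S.arc ⊆ S.peaString := by
  intro x hx
  obtain ⟨p, hp, t, rfl, ht, -⟩ := mem_arc_iff.1 hx
  refine ⟨hx.1, ?_⟩
  have ht_le : t ≤ S.radius := by
    have h := hx.2.2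
    rw [peaRadius_smul_axisDir_add hp, abs_of_nonneg ht] at h
    linarith [dist_nonneg (x := t • S.axisDir + p) (y := S.center)]
  have hdist : dist (t • S.axisDir + p) S.center = S.radius - t := by
    rw [← hx.2.2, peaRadius_smul_axisDir_add hp, abs_of_nonneg ht, add_sub_cancel_right]
  have hdir : (S.radius / dist (midpoint ℝ a b) S.center) • (midpoint ℝ a b - S.center) =
      S.radius • S.axisDir := by
    rw [dist_comm, ← apothem, axisDir, smul_smul, div_eq_mul_inv]
  have hmem : S.radius • S.axisDir + p ∈ S.directrix := by
    rw [directrix, AffineSubspace.mem_mk', hdir, vsub_eq_sub, add_comm (midpoint ℝ a b),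
      add_sub_add_left_eq_sub]
    exact AffineSubspace.vsub_mem_direction hp S.midpoint_mem_beamLine
  have hsplit : t • S.axisDir + p =
      (t - S.radius) • S.axisDir +ᵥ (S.radius • S.axisDir + p) := by
    rw [vadd_eq_add]
    module
  have hinf : infDist (t • S.axisDir + p) (S.directrix : Set E3) = |t - S.radius| := by
    rw [hsplit, infDist_vadd_of_mem_orthogonal_direction hmem, norm_smul, S.norm_axisDir, mul_one,
      Real.norm_eq_abs]
    rw [directrix, AffineSubspace.direction_mk']
    exact Submodule.smul_mem _ _ S.axisDir_mem_orthogonal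
  rw [hinf, hdist, abs_sub_comm, abs_of_nonneg (sub_nonneg.2 ht_le)]

theorem eq_or_eq_of_dist_midpoint (hp : p ∈ S.beamLine)
    (h : dist p (midpoint ℝ a b) = dist a b / 2) : p = a ∨ p = b := by
  obtain ⟨k, rfl⟩ := mem_affineSpan_pair_iff_exists_lineMap_eq.1 hp
  rw [midpoint, dist_lineMap_lineMap, div_eq_inv_mul] at h
  have habs := mul_right_cancel₀ (dist_pos.2 S.ends_ne).ne' h
  rw [Real.dist_eq, invOf_eq_inv] at habs
  obtain hk | hk := (abs_eq (by norm_num)).1 habs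
  · right
    rw [show k = 1 by linarith, AffineMap.lineMap_apply_one]
  · left
    rw [show k = 0 by linarith, AffineMap.lineMap_apply_zero]

theorem dist_add_peaRadius_lt_or (hx : x ∈ S.arc) {v : ℝ} (hv : v < S.apothem) :
    dist x (-v • S.axisDir + midpoint ℝ a b) + S.peaRadius x < √((dist a b / 2) ^ 2 + v ^ 2) ∨
      x = a ∨ x = b := by
  -- A pea is inside the principal circle and beyond the beam, where a circle through `a` and `b`
  -- bulges out the more the closer its center is to the beam.
  have hr := S.radius_sq
  have hur := S.apothem_lt_radius
  have hu := S.apothem_pos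
  have hℓ := half_pos (dist_pos.2 S.ends_ne)
  obtain ⟨p, hp, t, rfl, ht, hs⟩ := mem_arc_iff.1 hx
  obtain rfl | ht := ht.eq_or_lt
  · rw [mul_zero, zero_mul, sub_zero, sq_eq_sq₀ dist_nonneg hℓ.le] at hs
    rw [zero_smul, zero_add]
    exact .inr (eq_or_eq_of_dist_midpoint hp hs)
  left
  set ℓ := dist a b / 2
  set ρ := √(ℓ ^ 2 + v ^ 2)
  have hρ_sq : ρ ^ 2 = ℓ ^ 2 + v ^ 2 := Real.sq_sqrt (by positivity)
  have hℓρ : ℓ ≤ ρ := Real.le_sqrt_of_sq_le (by nlinarith)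
  have hℓr : ℓ < S.radius := lt_of_pow_lt_pow_left₀ 2 S.radius_nonneg (by nlinarith)
  have htρ : t < ρ := by
    have h : 2 * t * ℓ ≤ ℓ * ℓ := by nlinarith [sq_nonneg (dist p (midpoint ℝ a b))]
    linarith [le_of_mul_le_mul_right h hℓ]
  have hρ_lt : ρ < S.radius + S.apothem - v := by
    refine lt_of_pow_lt_pow_left₀ 2 (by linarith) ?_
    nlinarith
  have hdist : dist (t • S.axisDir + p) (-v • S.axisDir + midpoint ℝ a b) < ρ - t := by
    refine lt_of_pow_lt_pow_left₀ 2 (by linarith) ?_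
    rw [dist_sq_smul_axisDir_add hp S.midpoint_mem_beamLine, hs]
    nlinarith
  rw [peaRadius_smul_axisDir_add hp, abs_of_pos ht]
  linarith

variable (S) in
theorem dist_outer_le (x y : E3) : dist (S.outer x y) x ≤ S.peaRadius x := by
  have hpea : 0 ≤ S.peaRadius x := infDist_nonneg
  rw [outer, dist_self_add_left, norm_smul, ← dist_eq_norm,
    Real.norm_of_nonneg (div_nonneg hpea dist_nonneg), div_mul_eq_mul_div, mul_div_assoc]
  exact mul_le_of_le_one_right hpea (div_self_le_one _)

variable (S) in
theorem outer_of_mem_beamLine (hx : x ∈ S.beamLine) (y : E3) : S.outer x y = x := by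
  rw [outer, peaRadius, infDist_zero_of_mem hx, zero_div, zero_smul, add_zero]

theorem outer_mem_ball_union (hx : x ∈ S.arc) {v : ℝ} (hv : v < S.apothem) (y : E3) :
    S.outer x y ∈ ball (-v • S.axisDir + midpoint ℝ a b) √((dist a b / 2) ^ 2 + v ^ 2) ∪
      {a, b} := by
  obtain h | rfl | rfl := dist_add_peaRadius_lt_or hx hv
  · left
    have htri := dist_triangle (S.outer x y) x (-v • S.axisDir + midpoint ℝ a b)
    exact mem_ball.2 (by linarith [S.dist_outer_le x y])
  · right
    rw [S.outer_of_mem_beamLine S.left_mem_beamLine]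
    exact mem_insert _ _
  · right
    rw [S.outer_of_mem_beamLine S.right_mem_beamLine]
    exact mem_insert_of_mem _ rfl

variable (S) in
theorem left_mem_arc : a ∈ S.arc :=
  mem_arc_iff.2 ⟨a, S.left_mem_beamLine, 0, by rw [zero_smul, zero_add], le_rfl, by
    rw [dist_left_midpoint, Real.norm_ofNat]
    ring⟩

variable (S) in
theorem right_mem_arc : b ∈ S.arc :=
  mem_arc_iff.2 ⟨b, S.right_mem_beamLine, 0, by rw [zero_smul, zero_add], le_rfl, by
    rw [dist_right_midpoint, Real.norm_ofNat]
    ring⟩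

theorem ext_axisDir_apothem {S T : ParabolicPeaPod a b} (hdir : S.axisDir = T.axisDir)
    (hapothem : S.apothem = T.apothem) : S = T :=
  ParabolicPeaPod.ext (by rw [S.center_eq, T.center_eq, hdir, hapothem])

theorem exists_axisDir_eq_and_apothem_eq (hne : a ≠ b) {f : E3} (hfab : ⟪b - a, f⟫ = 0)
    (hf : ‖f‖ = 1) {u : ℝ} (hu : 0 < u) :
    ∃ S : ParabolicPeaPod a b, S.axisDir = f ∧ S.apothem = u := by
  have hmem : -u • f + midpoint ℝ a b ∈ AffineSubspace.perpBisector a b := by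
    rw [AffineSubspace.mem_perpBisector_iff_inner_eq_zero, vsub_eq_sub, add_sub_cancel_right,
      inner_smul_left, real_inner_comm, vsub_eq_sub, hfab, mul_zero]
  have hnorm : ‖-u • f‖ = u := by
    rw [norm_smul, hf, mul_one, norm_neg, Real.norm_of_nonneg hu.le]
  let S : ParabolicPeaPod a b := ⟨-u • f + midpoint ℝ a b, hne,
    AffineSubspace.mem_perpBisector_iff_dist_eq.1 hmem,
    fun h => hu.ne (by rw [← hnorm, add_eq_right.1 h, norm_zero])⟩
  have hapothem : S.apothem = u := by rw [apothem, dist_add_self_left, hnorm]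
  refine ⟨S, ?_, hapothem⟩
  rw [axisDir, hapothem, sub_add_cancel_right, neg_smul, neg_neg, inv_smul_smul₀ hu.ne']

end ParabolicPeaPod

/-! ### Convex confocal pairs -/

section ConvexConfocal

variable {a b c d : E3} {S : ParabolicPeaPod a b} {T : ParabolicPeaPod c d}

theorem IsConvexConfocal.of_isBulbCenter (haxis : S.axis = T.axis)
    (hplanes : S.plane.directionᗮ ⟂ T.plane.directionᗮ) (hS : T.IsBulbCenter S.center)
    (hT : S.IsBulbCenter T.center) : IsConvexConfocal S T where
  axis_eq := haxis
  planes_orthogonal := hplanes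
  left_focus_mem := ParabolicPeaPod.arc_subset_peaString hS.1
  right_focus_mem := ParabolicPeaPod.arc_subset_peaString hT.1
  left_center_bulb := hS
  right_center_bulb := hT

theorem IsConvexConfocal.symm (h : IsConvexConfocal S T) : IsConvexConfocal T S :=
  .of_isBulbCenter h.axis_eq.symm h.planes_orthogonal.symm h.right_center_bulb h.left_center_bulb

theorem IsConvexConfocal.axisDir_eq_neg_and_radius_add_apothem_eq (h : IsConvexConfocal S T) :
    T.axisDir = -S.axisDir ∧ T.radius + T.apothem = S.radius + S.apothem := by
  have hS := ParabolicPeaPod.isBulbCenter_iff.1 h.left_center_bulb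
  have hT := ParabolicPeaPod.isBulbCenter_iff.1 h.right_center_bulb
  have hSpos : 0 < S.radius + S.apothem := by linarith [S.apothem_pos, S.apothem_lt_radius]
  have hTpos : 0 < T.radius + T.apothem := by linarith [T.apothem_pos, T.apothem_lt_radius]
  have smul_eq : (T.radius + T.apothem) • T.axisDir = -((S.radius + S.apothem) • S.axisDir) := by
    have hST : (2 : ℝ) • (S.center - T.center) = (T.radius + T.apothem) • T.axisDir := by
      rw [hS, T.center_eq]
      module
    have hTS : (2 : ℝ) • (T.center - S.center) = (S.radius + S.apothem) • S.axisDir := by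
      rw [hT, S.center_eq]
      module
    rw [← hST, ← hTS, ← smul_neg, neg_sub]
  have sum_eq : T.radius + T.apothem = S.radius + S.apothem := by
    have hnorm := congrArg norm smul_eq
    rwa [norm_neg, norm_smul, norm_smul, S.norm_axisDir, T.norm_axisDir, mul_one, mul_one,
      Real.norm_of_nonneg hSpos.le, Real.norm_of_nonneg hTpos.le] at hnorm
  rw [sum_eq, ← smul_neg] at smul_eq
  exact ⟨smul_right_injective E3 hSpos.ne' smul_eq, sum_eq⟩

theorem IsConvexConfocal.apothem_eq_and_radius_eq (h : IsConvexConfocal S T)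
    (hbeam : dist c d = dist a b) : T.apothem = S.apothem ∧ T.radius = S.radius := by
  have hsum := h.axisDir_eq_neg_and_radius_add_apothem_eq.2
  have hS := S.radius_sq
  have hT := T.radius_sq
  rw [hbeam] at hT
  have hprod : (T.radius - T.apothem - (S.radius - S.apothem)) * (S.radius + S.apothem) = 0 := by
    linear_combination hT - hS - (T.radius - T.apothem) * hsum
  have hdiff := (mul_eq_zero.1 hprod).resolve_right
    (by linarith [S.apothem_pos, S.apothem_lt_radius])
  exact ⟨by linarith, by linarith⟩

theorem IsConvexConfocal.midpoint_sub_midpoint (h : IsConvexConfocal S T)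
    (hbeam : dist c d = dist a b) :
    midpoint ℝ a b - midpoint ℝ c d = ((3 * S.apothem - S.radius) / 2) • S.axisDir := by
  have hT := ParabolicPeaPod.isBulbCenter_iff.1 h.right_center_bulb
  rw [T.center_eq, h.axisDir_eq_neg_and_radius_add_apothem_eq.1,
    (h.apothem_eq_and_radius_eq hbeam).1, ← eq_sub_iff_add_eq'] at hT
  rw [hT]
  module

theorem planes_orthogonal_of_axisDir_eq_neg (hdir : T.axisDir = -S.axisDir)
    (hbeams : ⟪b - a, d - c⟫ = 0) : S.plane.directionᗮ ⟂ T.plane.directionᗮ := by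
  have hS := S.inner_sub_axisDir
  have hT : ⟪d - c, S.axisDir⟫ = 0 := by
    rw [← neg_neg S.axisDir, ← hdir, inner_neg_right, T.inner_sub_axisDir, neg_zero]
  let e : Fin 3 → E3 := ![b - a, d - c, S.axisDir]
  have he₀ (i : Fin 3) : e i ≠ 0 := by
    fin_cases i
    exacts [sub_ne_zero.2 S.ends_ne.symm, sub_ne_zero.2 T.ends_ne.symm,
      norm_ne_zero_iff.1 (S.norm_axisDir.trans_ne one_ne_zero)]
  have he : Pairwise fun i j => ⟪e i, e j⟫ = 0 := by
    intro i j hij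
    fin_cases i <;> fin_cases j <;> first
      | exact absurd rfl hij
      | assumption
      | exact (real_inner_comm _ _).trans ‹_›
  have hcard : Fintype.card (Fin 3) = finrank ℝ E3 := by
    rw [finrank_euclideanSpace]
  refine Submodule.isOrtho_iff_inner_eq.2 fun v hv w hw => ?_
  have hv_span : v ∈ ℝ ∙ (d - c) := by
    refine mem_span_singleton_of_inner_eq_zero (i := 1) he₀ he hcard fun j hj => ?_
    fin_cases j
    exacts [hv _ S.sub_mem_direction_plane, absurd rfl hj,
      hv _ S.axisDir_mem_direction_plane]
  obtain ⟨k, rfl⟩ := Submodule.mem_span_singleton.1 hv_span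
  rw [inner_smul_left, hw _ T.sub_mem_direction_plane, mul_zero]

theorem IsConvexConfocal.of_axisDir_eq_neg (hdir : T.axisDir = -S.axisDir)
    (hbeams : ⟪b - a, d - c⟫ = 0) (hbeam : dist c d = dist a b) (hapothem : T.apothem = S.apothem)
    (hmid : midpoint ℝ a b - midpoint ℝ c d = ((3 * S.apothem - S.radius) / 2) • S.axisDir) :
    IsConvexConfocal S T := by
  have hradius : T.radius = S.radius := by
    refine (sq_eq_sq₀ T.radius_nonneg S.radius_nonneg).1 ?_
    rw [T.radius_sq, S.radius_sq, hbeam, hapothem]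
  have hmid : midpoint ℝ c d =
      -((3 * S.apothem - S.radius) / 2) • S.axisDir + midpoint ℝ a b := by
    rw [neg_smul, ← hmid, neg_sub, sub_add_cancel]
  have haxis : S.axis = T.axis := by
    ext x
    rw [ParabolicPeaPod.mem_axis_iff, ParabolicPeaPod.mem_axis_iff, hdir, hmid]
    constructor
    · rintro ⟨t, rfl⟩
      refine ⟨-t - (3 * S.apothem - S.radius) / 2, ?_⟩
      module
    · rintro ⟨t, rfl⟩
      refine ⟨-t - (3 * S.apothem - S.radius) / 2, ?_⟩
      module
  refine .of_isBulbCenter haxis (planes_orthogonal_of_axisDir_eq_neg hdir hbeams) ?_ ?_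
  · rw [ParabolicPeaPod.isBulbCenter_iff, hdir, hradius, hapothem, S.center_eq, hmid]
    module
  · rw [ParabolicPeaPod.isBulbCenter_iff, T.center_eq, hdir, hapothem, hmid]
    module

end ConvexConfocal

/-! ### Opposite edges of a tetragonal disphenoid -/

/-- A tetragonal disphenoid, degenerate ones included: a tetrahedron `abcd` whose opposite edges
`ab` and `cd` are equally long, and whose other four edges are equally long. -/
structure IsTetragonalDisphenoid {P : Type*} [MetricSpace P] (a b c d : P) : Prop where
  ne : a ≠ b
  cd_eq : dist c d = dist a b
  ad_eq : dist a d = dist a c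
  bc_eq : dist b c = dist a c
  bd_eq : dist b d = dist a c

namespace IsTetragonalDisphenoid

section MetricSpace

variable {P : Type*} [MetricSpace P] {a b c d : P}

theorem symm (h : IsTetragonalDisphenoid a b c d) : IsTetragonalDisphenoid c d a b where
  ne := dist_pos.1 (h.cd_eq ▸ dist_pos.2 h.ne)
  cd_eq := h.cd_eq.symm
  ad_eq := by rw [dist_comm, h.bc_eq, dist_comm]
  bc_eq := by rw [dist_comm, h.ad_eq, dist_comm]
  bd_eq := by rw [dist_comm, h.bd_eq, dist_comm]

theorem swap_ab (h : IsTetragonalDisphenoid a b c d) : IsTetragonalDisphenoid b a c d where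
  ne := h.ne.symm
  cd_eq := h.cd_eq.trans (dist_comm a b)
  ad_eq := h.bd_eq.trans h.bc_eq.symm
  bc_eq := h.bc_eq.symm
  bd_eq := h.ad_eq.trans h.bc_eq.symm

end MetricSpace

section InnerProductSpace

variable {E : Type*} [NormedAddCommGroup E] [InnerProductSpace ℝ E] {a b c d : E}

theorem affineSpan_le_perpBisector (h : IsTetragonalDisphenoid a b c d) :
    line[ℝ, c, d] ≤ AffineSubspace.perpBisector a b := by
  refine affineSpan_le.2 (pair_subset ?_ ?_) <;>
    rw [SetLike.mem_coe, AffineSubspace.mem_perpBisector_iff_dist_eq', dist_comm, dist_comm b]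
  exacts [(dist_comm c a).trans (h.bc_eq.symm.trans (dist_comm b c)),
    (dist_comm d a).trans (h.ad_eq.trans (h.bd_eq.symm.trans (dist_comm b d)))]

theorem inner_sub_sub (h : IsTetragonalDisphenoid a b c d) : ⟪b - a, d - c⟫ = 0 := by
  have hdir := AffineSubspace.vsub_mem_direction
    (h.affineSpan_le_perpBisector (right_mem_affineSpan_pair ℝ c d))
    (h.affineSpan_le_perpBisector (left_mem_affineSpan_pair ℝ c d))
  rw [AffineSubspace.direction_perpBisector] at hdir
  exact Submodule.mem_orthogonal_singleton_iff_inner_right.1 hdir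

theorem inner_midpoint_sub (h : IsTetragonalDisphenoid a b c d) :
    ⟪midpoint ℝ c d - midpoint ℝ a b, b - a⟫ = 0 :=
  AffineSubspace.mem_perpBisector_iff_inner_eq_zero.1
    (h.affineSpan_le_perpBisector (AffineMap.lineMap_mem_affineSpan_pair _ c d))

theorem dist_midpoint_sq (h : IsTetragonalDisphenoid a b c d) :
    dist c (midpoint ℝ a b) ^ 2 = dist a c ^ 2 - (dist a b / 2) ^ 2 := by
  have hmedian :=
    EuclideanGeometry.dist_sq_add_dist_sq_eq_two_mul_dist_midpoint_sq_add_half_dist_sq c a b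
  rw [dist_comm c a, dist_comm c b, h.bc_eq] at hmedian
  linarith

theorem dist_sq (h : IsTetragonalDisphenoid a b c d) :
    dist a c ^ 2 = dist (midpoint ℝ a b) (midpoint ℝ c d) ^ 2 + 2 * (dist a b / 2) ^ 2 := by
  have hmedian :=
    EuclideanGeometry.dist_sq_add_dist_sq_eq_two_mul_dist_midpoint_sq_add_half_dist_sq
      (midpoint ℝ c d) a b
  have ha := h.symm.dist_midpoint_sq
  have hb := h.swap_ab.symm.dist_midpoint_sq
  rw [dist_comm c, h.cd_eq] at ha
  rw [dist_comm c, h.cd_eq, h.bc_eq] at hb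
  rw [dist_comm _ a, dist_comm _ b, ha, hb, dist_comm (midpoint ℝ c d)] at hmedian
  linarith

theorem dist_center (h : IsTetragonalDisphenoid a b c d) :
    dist a (midpoint ℝ (midpoint ℝ a b) (midpoint ℝ c d)) =
      √(dist a c ^ 2 / 4 + dist a b ^ 2 / 8) := by
  have hmedian :=
    EuclideanGeometry.dist_sq_add_dist_sq_eq_two_mul_dist_midpoint_sq_add_half_dist_sq
      a (midpoint ℝ a b) (midpoint ℝ c d)
  have ha := h.symm.dist_midpoint_sq
  have hL := h.dist_sq
  rw [dist_comm c, h.cd_eq] at ha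
  rw [ha, dist_left_midpoint, Real.norm_ofNat] at hmedian
  refine (Real.sqrt_eq_iff_eq_sq (by positivity) dist_nonneg).2 ?_ |>.symm
  linarith

theorem dist_le_four_mul_dist_midpoint (h : IsTetragonalDisphenoid a b c d)
    (hab : 3 * dist a b ≤ 4 * dist a c) :
    dist a b ≤ 4 * dist (midpoint ℝ a b) (midpoint ℝ c d) := by
  have hsq := pow_le_pow_left₀ (by positivity) hab 2
  rw [mul_pow, mul_pow, h.dist_sq] at hsq
  refine (sq_le_sq₀ dist_nonneg (by positivity)).1 ?_
  linarith

end InnerProductSpace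

variable {a b c d : E3}

theorem apothem_eq_and_axisDir_eq (h : IsTetragonalDisphenoid a b c d)
    (hab : 3 * dist a b ≤ 4 * dist a c) {S : ParabolicPeaPod a b} {T : ParabolicPeaPod c d}
    (hST : IsConvexConfocal S T) :
    S.apothem = (3 * dist (midpoint ℝ a b) (midpoint ℝ c d) + dist a c) / 4 ∧
      S.axisDir = (dist (midpoint ℝ a b) (midpoint ℝ c d))⁻¹ •
        (midpoint ℝ a b - midpoint ℝ c d) := by
  have hsub := hST.midpoint_sub_midpoint h.cd_eq
  have hr := S.radius_sq
  have hu := S.apothem_pos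
  have hur := S.apothem_lt_radius
  have hL := h.dist_sq
  have hab_pos := dist_pos.2 h.ne
  have hle := h.dist_le_four_mul_dist_midpoint hab
  have hD : |(3 * S.apothem - S.radius) / 2| = dist (midpoint ℝ a b) (midpoint ℝ c d) := by
    rw [dist_eq_norm, hsub, norm_smul, S.norm_axisDir, mul_one, Real.norm_eq_abs]
  set D := dist (midpoint ℝ a b) (midpoint ℝ c d)
  have hD_pos : 0 < D := by linarith
  obtain hD | hD := (abs_eq hD_pos.le).1 hD
  · refine ⟨?_, by rw [hsub, hD, inv_smul_smul₀ hD_pos.ne']⟩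
    have hsq : (4 * S.apothem - 3 * D) ^ 2 = dist a c ^ 2 := by
      rw [show S.radius = 3 * S.apothem - 2 * D by linarith] at hr
      linear_combination 2 * hr - hL
    linarith [(sq_eq_sq₀ (by linarith) dist_nonneg).1 hsq]
  -- Here the pods face away from each other, which would force `4 * D < dist a b`.
  · rw [show S.radius = 3 * S.apothem + 2 * D by linarith] at hr
    nlinarith

theorem exists_isConvexConfocal (h : IsTetragonalDisphenoid a b c d)
    (hab : 3 * dist a b ≤ 4 * dist a c) :
    ∃ (S : ParabolicPeaPod a b) (T : ParabolicPeaPod c d), IsConvexConfocal S T := by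
  have hL := h.dist_sq
  have hab_pos := dist_pos.2 h.ne
  have hle := h.dist_le_four_mul_dist_midpoint hab
  set D := dist (midpoint ℝ a b) (midpoint ℝ c d) with hD_def
  have hD : 0 < D := by linarith
  set f := D⁻¹ • (midpoint ℝ a b - midpoint ℝ c d) with hf_def
  have hf : ‖f‖ = 1 := by
    rw [norm_smul, ← dist_eq_norm, ← hD_def, norm_inv, Real.norm_of_nonneg hD.le,
      inv_mul_cancel₀ hD.ne']
  have hab_f : ⟪b - a, f⟫ = 0 := by
    rw [hf_def, inner_smul_right, ← neg_sub (midpoint ℝ c d), inner_neg_right, real_inner_comm,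
      h.inner_midpoint_sub, neg_zero, mul_zero]
  have hcd_f : ⟪d - c, -f⟫ = 0 := by
    rw [hf_def, inner_neg_right, inner_smul_right, real_inner_comm, h.symm.inner_midpoint_sub,
      mul_zero, neg_zero]
  have hu : 0 < (3 * D + dist a c) / 4 := by positivity
  obtain ⟨S, hS_dir, hS⟩ := ParabolicPeaPod.exists_axisDir_eq_and_apothem_eq h.ne hab_f hf hu
  obtain ⟨T, hT_dir, hT⟩ := ParabolicPeaPod.exists_axisDir_eq_and_apothem_eq h.symm.ne hcd_f
    ((norm_neg f).trans hf) hu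
  have hr : S.radius = 3 * S.apothem - 2 * D := by
    refine (sq_eq_sq₀ S.radius_nonneg (by linarith [dist_nonneg (x := a) (y := c)])).1 ?_
    rw [S.radius_sq, hS]
    linear_combination -hL / 2
  refine ⟨S, T, .of_axisDir_eq_neg (hT_dir.trans (congrArg Neg.neg hS_dir.symm))
    h.inner_sub_sub h.cd_eq (hT.trans hS.symm) ?_⟩
  rw [hr, hS_dir, show (3 * S.apothem - (3 * S.apothem - 2 * D)) / 2 = D by ring,
    smul_inv_smul₀ hD.ne']

theorem existsUnique_isConvexConfocal (h : IsTetragonalDisphenoid a b c d)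
    (hab : 3 * dist a b ≤ 4 * dist a c) :
    ∃! S : ParabolicPeaPod a b × ParabolicPeaPod c d, IsConvexConfocal S.1 S.2 := by
  have hcd : 3 * dist c d ≤ 4 * dist c a := by rwa [h.cd_eq, dist_comm c]
  obtain ⟨S, T, hST⟩ := h.exists_isConvexConfocal hab
  refine ⟨(S, T), hST, fun ⟨S', T'⟩ hST' => Prod.ext ?_ ?_⟩
  · obtain ⟨hu, hf⟩ := h.apothem_eq_and_axisDir_eq hab hST
    obtain ⟨hu', hf'⟩ := h.apothem_eq_and_axisDir_eq hab hST'
    exact ParabolicPeaPod.ext_axisDir_apothem (hf'.trans hf.symm) (hu'.trans hu.symm)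
  · obtain ⟨hu, hf⟩ := h.symm.apothem_eq_and_axisDir_eq hcd hST.symm
    obtain ⟨hu', hf'⟩ := h.symm.apothem_eq_and_axisDir_eq hcd hST'.symm
    exact ParabolicPeaPod.ext_axisDir_apothem (hf'.trans hf.symm) (hu'.trans hu.symm)

theorem outer_mem_ball_union (h : IsTetragonalDisphenoid a b c d)
    (hab : 3 * dist a b ≤ 4 * dist a c) {S : ParabolicPeaPod a b} {T : ParabolicPeaPod c d}
    (hST : IsConvexConfocal S T) {x : E3} (hx : x ∈ S.arc) (y : E3) :
    S.outer x y ∈ ball (midpoint ℝ (midpoint ℝ a b) (midpoint ℝ c d))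
      √(dist a c ^ 2 / 4 + dist a b ^ 2 / 8) ∪ {a, b} := by
  obtain ⟨hu, hf⟩ := h.apothem_eq_and_axisDir_eq hab hST
  have hL := h.dist_sq
  have hle := h.dist_le_four_mul_dist_midpoint hab
  have hab_pos := dist_pos.2 h.ne
  set m := midpoint ℝ a b
  set n := midpoint ℝ c d
  have hD : 0 < dist m n := by linarith
  have hcenter : -(dist m n / 2) • S.axisDir + m = midpoint ℝ m n := by
    rw [hf, smul_smul, neg_div', div_mul_eq_mul_div, neg_mul, mul_inv_cancel₀ hD.ne',
      midpoint_eq_smul_add, invOf_eq_inv]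
    module
  have hradius : dist a c ^ 2 / 4 + dist a b ^ 2 / 8 = (dist a b / 2) ^ 2 + (dist m n / 2) ^ 2 := by
    linear_combination hL / 4
  rw [← hcenter, hradius]
  exact ParabolicPeaPod.outer_mem_ball_union hx
    (by linarith [dist_nonneg (x := a) (y := c)]) y

end IsTetragonalDisphenoid

/-! ### Permuting the vertices -/

namespace ParabolicPeaPod

variable {a b : E3} (S : ParabolicPeaPod a b)

/-- The same pea pod with the ends of its beam exchanged. -/
def flip : ParabolicPeaPod b a where
  center := S.center
  ends_ne := S.ends_ne.symm
  dist_ends := S.dist_ends.symm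
  center_ne := midpoint_comm (R := ℝ) a b ▸ S.center_ne

@[simp]
theorem flip_center : S.flip.center = S.center := rfl

@[simp]
theorem flip_radius : S.flip.radius = S.radius := S.dist_ends.symm

@[simp]
theorem flip_plane : S.flip.plane = S.plane :=
  congrArg (affineSpan ℝ) (insert_comm b a {S.center})

@[simp]
theorem flip_axis : S.flip.axis = S.axis := by
  rw [axis, axis, midpoint_comm, flip_center]

@[simp]
theorem flip_beamLine : S.flip.beamLine = S.beamLine :=
  congrArg (affineSpan ℝ) (pair_comm b a)

@[simp]
theorem flip_peaRadius : S.flip.peaRadius = S.peaRadius := by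
  ext x
  rw [peaRadius, peaRadius, flip_beamLine]

@[simp]
theorem flip_arc : S.flip.arc = S.arc := by
  simp only [arc, flip_plane, flip_beamLine, flip_center, flip_peaRadius, flip_radius]

@[simp]
theorem flip_outer : S.flip.outer = S.outer := by
  ext1 x
  ext1 y
  rw [outer, outer, flip_peaRadius]

@[simp]
theorem flip_edgeCurve (v : E3) : S.flip.edgeCurve v = S.edgeCurve v := by
  rw [edgeCurve, edgeCurve, flip_outer, flip_arc]

end ParabolicPeaPod

section VertexSwap

variable {a b c d : E3} (S : ParabolicPeaPod a b) (T : ParabolicPeaPod c d)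

variable {S T} in
theorem IsConvexConfocal.flip_left (h : IsConvexConfocal S T) : IsConvexConfocal S.flip T := by
  refine .of_isBulbCenter ?_ ?_ h.left_center_bulb ?_
  · rw [S.flip_axis, h.axis_eq]
  · rw [S.flip_plane]
    exact h.planes_orthogonal
  · rw [ParabolicPeaPod.IsBulbCenter, S.flip_arc, S.flip_axis]
    exact h.right_center_bulb

@[simp]
theorem wedgePod_flip_left : wedgePod S.flip T = wedgePod S T := by
  rw [wedgePod, wedgePod, S.flip_outer, S.flip_arc]

@[simp]
theorem wedgePod_flip_right : wedgePod S T.flip = wedgePod S T := by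
  rw [wedgePod, wedgePod, T.flip_arc]

theorem reuleaux_swap_ab : reuleaux b a c d = reuleaux a b c d := by
  rw [reuleaux, reuleaux, inter_comm (closedBall b 2)]

theorem reuleaux_swap_bc : reuleaux a c b d = reuleaux a b c d := by
  rw [reuleaux, reuleaux, inter_right_comm (closedBall a 2)]

theorem reuleaux_swap_cd : reuleaux a b d c = reuleaux a b c d :=
  inter_right_comm _ _ _

end VertexSwap

namespace ParabolicDevices

variable {a b c d : E3} (P : ParabolicDevices a b c d)

/-- The devices after exchanging the labels `a` and `b`. -/
def swapAB : ParabolicDevices b a c d where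
  ab := P.ab.flip
  cd := P.cd
  ac := P.bc
  bd := P.ad
  ad := P.bd
  bc := P.ac
  ab_cd := P.ab_cd.flip_left
  ac_bd := P.ad_bc.symm
  ad_bc := P.ac_bd.symm

/-- The devices after exchanging the labels `b` and `c`. -/
def swapBC : ParabolicDevices a c b d where
  ab := P.ac
  cd := P.bd
  ac := P.ab
  bd := P.cd
  ad := P.ad
  bc := P.bc.flip
  ab_cd := P.ac_bd
  ac_bd := P.ab_cd
  ad_bc := P.ad_bc.symm.flip_left.symm

/-- The devices after exchanging the labels `c` and `d`. -/
def swapCD : ParabolicDevices a b d c where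
  ab := P.ab
  cd := P.cd.flip
  ac := P.ad
  bd := P.bc
  ad := P.ac
  bc := P.bd
  ab_cd := P.ab_cd.symm.flip_left.symm
  ac_bd := P.ad_bc
  ad_bc := P.ac_bd

theorem surface_swapAB : P.swapAB.surface = P.surface := by
  simp only [surface, wedges, caps, swapAB, reuleaux_swap_ab, wedgePod_flip_left,
    wedgePod_flip_right, ParabolicPeaPod.flip_edgeCurve, union_comm, union_left_comm]

theorem surface_swapBC : P.swapBC.surface = P.surface := by
  simp only [surface, wedges, caps, swapBC, reuleaux_swap_bc, wedgePod_flip_left,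
    wedgePod_flip_right, ParabolicPeaPod.flip_edgeCurve, union_comm, union_left_comm]

theorem surface_swapCD : P.swapCD.surface = P.surface := by
  simp only [surface, wedges, caps, swapCD, reuleaux_swap_cd, wedgePod_flip_left,
    wedgePod_flip_right, ParabolicPeaPod.flip_edgeCurve, union_comm, union_left_comm]

end ParabolicDevices

theorem IsRobertsBody.comp_perm (σ : Equiv.Perm (Fin 4)) (v : Fin 4 → E3) {R : Set E3}
    (h : IsRobertsBody (v 0) (v 1) (v 2) (v 3) R) :
    IsRobertsBody (v (σ 0)) (v (σ 1)) (v (σ 2)) (v (σ 3)) R := by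
  have hσ : σ ∈ Submonoid.closure (range fun i : Fin 3 => Equiv.swap i.castSucc i.succ) := by
    rw [Equiv.Perm.mclosure_swap_castSucc_succ]
    exact Submonoid.mem_top σ
  induction hσ using Submonoid.closure_induction generalizing v with
  | mem _ hτ =>
    obtain ⟨i, rfl⟩ := hτ
    obtain ⟨P, rfl⟩ := h
    fin_cases i
    · exact ⟨P.swapAB, congrArg (convexHull ℝ) P.surface_swapAB.symm⟩
    · exact ⟨P.swapBC, congrArg (convexHull ℝ) P.surface_swapBC.symm⟩
    · exact ⟨P.swapCD, congrArg (convexHull ℝ) P.surface_swapCD.symm⟩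
  | one => exact h
  | mul τ _ _ _ ih₁ ih₂ => exact ih₂ (v ∘ τ) (ih₁ v h)

/-! ### Isometries -/

namespace ParabolicPeaPod

variable {a b : E3} (g : E3 ≃ᵃⁱ[ℝ] E3) (S : ParabolicPeaPod a b)

/-- The image of a pea pod under an isometry. -/
def map : ParabolicPeaPod (g a) (g b) where
  center := g S.center
  ends_ne := g.injective.ne S.ends_ne
  dist_ends := by rw [g.dist_map, g.dist_map, S.dist_ends]
  center_ne := g.toAffineEquiv.map_midpoint a b ▸ g.injective.ne S.center_ne

@[simp]
theorem map_center : (S.map g).center = g S.center := rfl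

theorem map_radius : (S.map g).radius = S.radius := g.dist_map _ _

theorem map_plane : (S.map g).plane = S.plane.map (g : E3 →ᵃ[ℝ] E3) := by
  rw [plane, plane, AffineSubspace.map_span, image_insert_eq, image_pair]
  rfl

theorem map_axis : (S.map g).axis = S.axis.map (g : E3 →ᵃ[ℝ] E3) := by
  rw [axis, axis, AffineSubspace.map_span, image_pair]
  exact congrArg (fun m => line[ℝ, g S.center, m]) (g.toAffineEquiv.map_midpoint a b).symm

theorem map_beamLine : (S.map g).beamLine = S.beamLine.map (g : E3 →ᵃ[ℝ] E3) := by
  rw [beamLine, beamLine, AffineSubspace.map_span, image_pair]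
  rfl

theorem map_peaRadius (x : E3) : (S.map g).peaRadius (g x) = S.peaRadius x := by
  rw [peaRadius, peaRadius, map_beamLine, AffineSubspace.coe_map]
  exact infDist_image g.isometry

theorem apply_mem_map_arc_iff {x : E3} : g x ∈ (S.map g).arc ↔ x ∈ S.arc := by
  have hplane : g x ∈ (S.map g).plane ↔ x ∈ S.plane := by
    rw [map_plane]
    exact AffineSubspace.mem_map_iff_mem_of_injective g.injective
  have hside : (S.map g).beamLine.WOppSide (g S.center) (g x) ↔
      S.beamLine.WOppSide S.center x := by
    rw [map_beamLine]
    exact Function.Injective.wOppSide_map_iff (f := (g : E3 →ᵃ[ℝ] E3)) g.injective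
  rw [arc, arc, mem_ofPred_eq, mem_ofPred_eq, hplane, map_center, hside, map_peaRadius,
    map_radius, g.dist_map]

theorem map_arc : (S.map g).arc = g '' S.arc := by
  ext y
  obtain ⟨x, rfl⟩ := g.surjective y
  rw [apply_mem_map_arc_iff, g.injective.mem_set_image]

theorem map_outer (x y : E3) : (S.map g).outer (g x) (g y) = g (S.outer x y) := by
  rw [outer, outer, map_peaRadius, g.dist_map, add_comm, add_comm x, ← vadd_eq_add _ x, g.map_vadd,
    map_smul, ← vsub_eq_sub x, g.map_vsub]
  rfl

theorem map_edgeCurve (v : E3) : (S.map g).edgeCurve (g v) = g '' S.edgeCurve v := by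
  rw [edgeCurve, edgeCurve, map_arc, image_image, image_image]
  simp only [map_outer]

theorem IsBulbCenter.map {S : ParabolicPeaPod a b} {x : E3} (h : S.IsBulbCenter x) :
    (S.map g).IsBulbCenter (g x) := by
  refine ⟨(S.apply_mem_map_arc_iff g).2 h.1, ?_⟩
  rw [map_axis]
  exact AffineSubspace.mem_map_of_mem _ h.2

end ParabolicPeaPod

section Isometry

variable {a b c d : E3} (g : E3 ≃ᵃⁱ[ℝ] E3)

theorem IsConvexConfocal.map {S : ParabolicPeaPod a b} {T : ParabolicPeaPod c d}
    (h : IsConvexConfocal S T) : IsConvexConfocal (S.map g) (T.map g) := by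
  refine .of_isBulbCenter ?_ ?_ (h.left_center_bulb.map g) (h.right_center_bulb.map g)
  · rw [S.map_axis, T.map_axis, h.axis_eq]
  · rw [S.map_plane, T.map_plane, AffineSubspace.map_direction, AffineSubspace.map_direction]
    have map_orthogonal (K : Submodule ℝ E3) :
        (K.map (g : E3 →ᵃ[ℝ] E3).linear)ᗮ = Kᗮ.map (g : E3 →ᵃ[ℝ] E3).linear :=
      (Submodule.map_orthogonal_equiv K g.linearIsometryEquiv).symm
    rw [map_orthogonal, map_orthogonal]
    exact h.planes_orthogonal.map g.linearIsometryEquiv.toLinearIsometry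

theorem wedgePod_map (S : ParabolicPeaPod a b) (T : ParabolicPeaPod c d) :
    wedgePod (S.map g) (T.map g) = g '' wedgePod S T := by
  rw [wedgePod, wedgePod, S.map_arc, T.map_arc, image2_image_left, image2_image_right,
    image_image2]
  exact image2_congr' (S.map_outer g)

theorem reuleaux_map : reuleaux (g a) (g b) (g c) (g d) = g '' reuleaux a b c d := by
  have image_closedBall (x : E3) : g '' closedBall x 2 = closedBall (g x) 2 :=
    g.toIsometryEquiv.image_closedBall x 2
  simp only [reuleaux, image_inter g.injective, image_closedBall]

theorem cap_map (K : Set E3) (v : E3) (Γ : Set E3) :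
    cap (g '' K) (g v) (g '' Γ) = g '' cap K v Γ := by
  have hsphere : sphere (g v) 2 \ g '' Γ = g '' (sphere v 2 \ Γ) := by
    rw [image_sdiff g.injective]
    exact congrArg (· \ g '' Γ) (g.toIsometryEquiv.image_sphere v 2).symm
  have hfrontier : frontier (g '' K) = g '' frontier K := (g.toHomeomorph.image_frontier K).symm
  have hcomponent {x : E3} (hx : x ∈ sphere v 2 \ Γ) :
      connectedComponentIn (g '' (sphere v 2 \ Γ)) (g x) =
        g '' connectedComponentIn (sphere v 2 \ Γ) x :=
    (g.toHomeomorph.image_connectedComponentIn hx).symm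
  rw [cap, cap, image_union, hsphere, hfrontier]
  congr 1
  ext y
  obtain ⟨x, rfl⟩ := g.surjective y
  rw [g.injective.mem_set_image, mem_ofPred_eq, mem_ofPred_eq, g.injective.mem_set_image]
  refine and_congr_right fun hx => ?_
  rw [hcomponent hx, image_subset_image_iff g.injective]

/-- The image of a choice of pea pods under an isometry. -/
def ParabolicDevices.map (P : ParabolicDevices a b c d) :
    ParabolicDevices (g a) (g b) (g c) (g d) where
  ab := P.ab.map g
  cd := P.cd.map g
  ac := P.ac.map g
  bd := P.bd.map g
  ad := P.ad.map g
  bc := P.bc.map g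
  ab_cd := P.ab_cd.map g
  ac_bd := P.ac_bd.map g
  ad_bc := P.ad_bc.map g

theorem ParabolicDevices.surface_map (P : ParabolicDevices a b c d) :
    (P.map g).surface = g '' P.surface := by
  simp only [surface, wedges, caps, ParabolicDevices.map, wedgePod_map,
    ParabolicPeaPod.map_edgeCurve, reuleaux_map, ← image_union, cap_map]

theorem IsRobertsBody.map {R : Set E3} (h : IsRobertsBody a b c d R) :
    IsRobertsBody (g a) (g b) (g c) (g d) (g '' R) := by
  obtain ⟨P, rfl⟩ := h
  refine ⟨P.map g, ?_⟩
  rw [P.surface_map]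
  exact (g.toAffineEquiv : E3 →ᵃ[ℝ] E3).image_convexHull _

end Isometry

/-! ### Circumscribed ball and symmetries of the body -/

theorem range_vecCons_four {α : Type*} (a b c d : α) : range ![a, b, c, d] = {a, b, c, d} := by
  simp only [Matrix.range_cons, Matrix.range_empty, union_empty, singleton_union]

theorem exists_perm_of_image_range_eq {ι α : Type*} {v : ι → α} (hv : Function.Injective v)
    {g : α → α} (hg : Function.Injective g) (h : g '' range v = range v) :
    ∃ σ : Equiv.Perm ι, ∀ i, v (σ i) = g (v i) := by
  refine ⟨(Equiv.ofInjective (g ∘ v) (hg.comp hv)).trans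
    ((Equiv.setCongr (by rw [range_comp, h])).trans (Equiv.ofInjective v hv).symm), fun i => ?_⟩
  exact Equiv.apply_ofInjective_symm hv _

section Surface

variable {a b c d : E3}

theorem isClosed_reuleaux : IsClosed (reuleaux a b c d) :=
  ((isClosed_closedBall.inter isClosed_closedBall).inter isClosed_closedBall).inter
    isClosed_closedBall

theorem cap_subset {K B Γ : Set E3} {v : E3} (hK : IsClosed K) (hKB : K ⊆ B) (hΓ : Γ ⊆ B) :
    cap K v Γ ⊆ B :=
  union_subset hΓ fun _ hp => hKB (hK.frontier_subset (hp.2 (mem_connectedComponentIn hp.1)))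

namespace ParabolicDevices

variable (P : ParabolicDevices a b c d)

theorem surface_subset {B : Set E3} (hB : reuleaux a b c d ⊆ B)
    (hab : ∀ x ∈ P.ab.arc, ∀ y, P.ab.outer x y ∈ B)
    (hcd : ∀ x ∈ P.cd.arc, ∀ y, P.cd.outer x y ∈ B)
    (hac : ∀ x ∈ P.ac.arc, ∀ y, P.ac.outer x y ∈ B)
    (hbd : ∀ x ∈ P.bd.arc, ∀ y, P.bd.outer x y ∈ B)
    (had : ∀ x ∈ P.ad.arc, ∀ y, P.ad.outer x y ∈ B)
    (hbc : ∀ x ∈ P.bc.arc, ∀ y, P.bc.outer x y ∈ B) : P.surface ⊆ B := by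
  have wedgePod_subset {p q r s : E3} {S : ParabolicPeaPod p q} {T : ParabolicPeaPod r s}
      (hS : ∀ x ∈ S.arc, ∀ y, S.outer x y ∈ B) : wedgePod S T ⊆ B :=
    image2_subset_iff.2 fun x hx y _ => hS x hx y
  have edgeCurve_subset {p q v : E3} {S : ParabolicPeaPod p q}
      (hS : ∀ x ∈ S.arc, ∀ y, S.outer x y ∈ B) : S.edgeCurve v ⊆ B :=
    image_subset_iff.2 fun x hx => hS x hx v
  have cap_subset {v : E3} {Γ₁ Γ₂ Γ₃ : Set E3} (h₁ : Γ₁ ⊆ B) (h₂ : Γ₂ ⊆ B) (h₃ : Γ₃ ⊆ B) :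
      cap (reuleaux a b c d) v (Γ₁ ∪ Γ₂ ∪ Γ₃) ⊆ B :=
    cap_subset isClosed_reuleaux hB (union_subset (union_subset h₁ h₂) h₃)
  simp only [surface, wedges, caps, union_subset_iff]
  exact ⟨⟨⟨⟨⟨⟨wedgePod_subset hab, wedgePod_subset hcd⟩, wedgePod_subset hac⟩,
    wedgePod_subset hbd⟩, wedgePod_subset had⟩, wedgePod_subset hbc⟩,
    ⟨⟨cap_subset (edgeCurve_subset hbc) (edgeCurve_subset hcd) (edgeCurve_subset hbd),
      cap_subset (edgeCurve_subset hcd) (edgeCurve_subset had) (edgeCurve_subset hac)⟩,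
      cap_subset (edgeCurve_subset hab) (edgeCurve_subset hbd) (edgeCurve_subset had)⟩,
      cap_subset (edgeCurve_subset hab) (edgeCurve_subset hbc) (edgeCurve_subset hac)⟩

theorem vertices_subset_surface : {a, b, c, d} ⊆ P.surface := by
  have mem_wedgePod {p q r s x : E3} {S : ParabolicPeaPod p q} (T : ParabolicPeaPod r s)
      (harc : x ∈ S.arc) (hbeam : x ∈ S.beamLine) : x ∈ wedgePod S T :=
    ⟨x, harc, r, T.left_mem_arc, S.outer_of_mem_beamLine hbeam r⟩
  have ha := mem_wedgePod P.cd P.ab.left_mem_arc P.ab.left_mem_beamLine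
  have hb := mem_wedgePod P.cd P.ab.right_mem_arc P.ab.right_mem_beamLine
  have hc := mem_wedgePod P.ab P.cd.left_mem_arc P.cd.left_mem_beamLine
  have hd := mem_wedgePod P.ab P.cd.right_mem_arc P.cd.right_mem_beamLine
  rintro x (rfl | rfl | rfl | rfl) <;> simp only [surface, wedges, mem_union, *, true_or, or_true]

end ParabolicDevices

end Surface

section Center

variable {E : Type*} [AddCommGroup E] [Module ℝ E]

theorem midpoint_midpoint_midpoint_comm (a b c d : E) :
    midpoint ℝ (midpoint ℝ a b) (midpoint ℝ c d) =
      midpoint ℝ (midpoint ℝ a c) (midpoint ℝ b d) := by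
  simp only [midpoint_eq_smul_add]
  module

theorem midpoint_midpoint_mem_convexHull (a b c d : E) :
    midpoint ℝ (midpoint ℝ a b) (midpoint ℝ c d) ∈ convexHull ℝ {a, b, c, d} := by
  have hmem {x : E} (hx : x ∈ ({a, b, c, d} : Set E)) : x ∈ convexHull ℝ {a, b, c, d} :=
    subset_convexHull ℝ _ hx
  have hconv := convex_convexHull ℝ ({a, b, c, d} : Set E)
  exact hconv.midpoint_mem (hconv.midpoint_mem (hmem (by simp)) (hmem (by simp)))
    (hconv.midpoint_mem (hmem (by simp)) (hmem (by simp)))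

end Center

section Circumball

variable (a b c d : E3)

/-- The open ball bounded by the circumscribed sphere of a regular tetrahedron with sides of length
`2`, together with the vertices; the circumcenter is encoded as the midpoint between the midpoints
of two opposite edges. -/
def circumballWithVertices : Set E3 :=
  ball (midpoint ℝ (midpoint ℝ a b) (midpoint ℝ c d)) √(3 / 2) ∪ {a, b, c, d}

theorem circumballWithVertices_swap_bc :
    circumballWithVertices a c b d = circumballWithVertices a b c d := by
  rw [circumballWithVertices, midpoint_midpoint_midpoint_comm, insert_comm c b,
    circumballWithVertices]

theorem circumballWithVertices_swap_cd :
    circumballWithVertices a b d c = circumballWithVertices a b c d := by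
  rw [circumballWithVertices, midpoint_comm d c, pair_comm d c, circumballWithVertices]

theorem circumballWithVertices_symm :
    circumballWithVertices c d a b = circumballWithVertices a b c d := by
  rw [circumballWithVertices, midpoint_comm, insert_comm d, insert_comm c, pair_comm d,
    insert_comm c, circumballWithVertices]

end Circumball

namespace IsRegularTetrahedron

variable {a b c d : E3} (h : IsRegularTetrahedron a b c d)
include h

theorem swap_ab : IsRegularTetrahedron b a c d :=
  ⟨(dist_comm b a).trans h.ab, h.bc, h.bd, h.ac, h.ad, h.cd⟩

theorem symm : IsRegularTetrahedron c d a b :=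
  ⟨h.cd, (dist_comm c a).trans h.ac, (dist_comm c b).trans h.bc, (dist_comm d a).trans h.ad,
    (dist_comm d b).trans h.bd, h.ab⟩

theorem swap_bc : IsRegularTetrahedron a c b d :=
  ⟨h.ac, h.ab, h.ad, (dist_comm c b).trans h.bc, h.cd, h.bd⟩

theorem swap_cd : IsRegularTetrahedron a b d c :=
  ⟨h.ab, h.ad, h.ac, h.bd, h.bc, (dist_comm d c).trans h.cd⟩

theorem map (g : E3 ≃ᵃⁱ[ℝ] E3) : IsRegularTetrahedron (g a) (g b) (g c) (g d) := by
  constructor <;> rw [g.dist_map]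
  exacts [h.ab, h.ac, h.ad, h.bc, h.bd, h.cd]

theorem isTetragonalDisphenoid : IsTetragonalDisphenoid a b c d where
  ne := dist_pos.1 (h.ab ▸ two_pos)
  cd_eq := h.cd.trans h.ab.symm
  ad_eq := h.ad.trans h.ac.symm
  bc_eq := h.bc.trans h.ac.symm
  bd_eq := h.bd.trans h.ac.symm

theorem three_mul_dist_le : 3 * dist a b ≤ 4 * dist a c := by
  rw [h.ab, h.ac]
  norm_num

theorem existsUnique_isConvexConfocal :
    ∃! S : ParabolicPeaPod a b × ParabolicPeaPod c d, IsConvexConfocal S.1 S.2 :=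
  h.isTetragonalDisphenoid.existsUnique_isConvexConfocal h.three_mul_dist_le

theorem nonempty_parabolicDevices : Nonempty (ParabolicDevices a b c d) := by
  obtain ⟨⟨S₁, T₁⟩, h₁⟩ := h.existsUnique_isConvexConfocal.exists
  obtain ⟨⟨S₂, T₂⟩, h₂⟩ := h.swap_bc.existsUnique_isConvexConfocal.exists
  obtain ⟨⟨S₃, T₃⟩, h₃⟩ := h.swap_cd.swap_bc.existsUnique_isConvexConfocal.exists
  exact ⟨⟨S₁, T₁, S₂, T₂, S₃, T₃, h₁, h₂, h₃⟩⟩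

theorem subsingleton_parabolicDevices : Subsingleton (ParabolicDevices a b c d) where
  allEq := by
    rintro ⟨ab, cd, ac, bd, ad, bc, h₁, h₂, h₃⟩ ⟨ab', cd', ac', bd', ad', bc', h₁', h₂', h₃'⟩
    obtain ⟨⟩ := h.existsUnique_isConvexConfocal.unique (y₁ := (ab, cd)) (y₂ := (ab', cd')) h₁ h₁'
    obtain ⟨⟩ := h.swap_bc.existsUnique_isConvexConfocal.unique (y₁ := (ac, bd)) (y₂ := (ac', bd'))
      h₂ h₂'
    obtain ⟨⟩ := h.swap_cd.swap_bc.existsUnique_isConvexConfocal.unique (y₁ := (ad, bc))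
      (y₂ := (ad', bc')) h₃ h₃'
    rfl

theorem existsUnique_isRobertsBody : ∃! R : Set E3, IsRobertsBody a b c d R := by
  obtain ⟨P⟩ := h.nonempty_parabolicDevices
  refine ⟨_, ⟨P, rfl⟩, ?_⟩
  rintro R ⟨Q, rfl⟩
  rw [h.subsingleton_parabolicDevices.elim Q P]

theorem pairwise_dist_eq :
    Pairwise fun i j => dist (![a, b, c, d] i) (![a, b, c, d] j) = 2 := by
  intro i j hij
  fin_cases i <;> fin_cases j <;>
    first
    | exact absurd rfl hij
    | simp [h.ab, h.ac, h.ad, h.bc, h.bd, h.cd, dist_comm]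

theorem circumradius_eq : √(dist a c ^ 2 / 4 + dist a b ^ 2 / 8) = √(3 / 2) := by
  rw [h.ab, h.ac]
  norm_num

theorem dist_center : dist a (midpoint ℝ (midpoint ℝ a b) (midpoint ℝ c d)) = √(3 / 2) :=
  h.isTetragonalDisphenoid.dist_center.trans h.circumradius_eq

theorem vertices_subset_sphere :
    {a, b, c, d} ⊆ sphere (midpoint ℝ (midpoint ℝ a b) (midpoint ℝ c d)) √(3 / 2) := by
  rintro x (rfl | rfl | rfl | rfl)
  · exact h.dist_center
  · rw [midpoint_comm a x]
    exact h.swap_ab.dist_center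
  · rw [midpoint_comm (midpoint ℝ a b)]
    exact h.symm.dist_center
  · rw [midpoint_comm (midpoint ℝ a b), midpoint_comm c x]
    exact h.swap_cd.symm.dist_center

theorem reuleaux_subset : reuleaux a b c d ⊆ circumballWithVertices a b c d := by
  intro x hx
  rw [circumballWithVertices, ← range_vecCons_four]
  refine mem_ball_union_range_of_pairwise_dist_eq h.pairwise_dist_eq two_pos (by simp)
    (by positivity) (fun i => ?_) fun i => ?_
  · exact mem_sphere'.1 (h.vertices_subset_sphere (range_vecCons_four a b c d ▸ mem_range_self i))
  · obtain ⟨⟨⟨ha, hb⟩, hc⟩, hd⟩ := hx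
    fin_cases i <;> assumption

theorem outer_mem_circumballWithVertices {S : ParabolicPeaPod a b} {T : ParabolicPeaPod c d}
    (hST : IsConvexConfocal S T) {x : E3} (hx : x ∈ S.arc) (y : E3) :
    S.outer x y ∈ circumballWithVertices a b c d := by
  refine union_subset_union_right _ ?_
    (h.circumradius_eq ▸ h.isTetragonalDisphenoid.outer_mem_ball_union h.three_mul_dist_le hST hx y)
  rintro x (rfl | rfl) <;> simp

theorem surface_subset_circumballWithVertices (P : ParabolicDevices a b c d) :
    P.surface ⊆ circumballWithVertices a b c d := by
  have hacbd := h.swap_bc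
  have hadbc := h.swap_cd.swap_bc
  have hball_acbd := circumballWithVertices_swap_bc a b c d
  have hball_adbc :=
    (circumballWithVertices_swap_bc a b d c).trans (circumballWithVertices_swap_cd a b c d)
  refine P.surface_subset h.reuleaux_subset (fun x hx y => ?_) (fun x hx y => ?_)
    (fun x hx y => ?_) (fun x hx y => ?_) (fun x hx y => ?_) fun x hx y => ?_
  · exact h.outer_mem_circumballWithVertices P.ab_cd hx y
  · rw [← circumballWithVertices_symm]
    exact h.symm.outer_mem_circumballWithVertices P.ab_cd.symm hx y
  · rw [← hball_acbd]
    exact hacbd.outer_mem_circumballWithVertices P.ac_bd hx y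
  · rw [← hball_acbd, ← circumballWithVertices_symm]
    exact hacbd.symm.outer_mem_circumballWithVertices P.ac_bd.symm hx y
  · rw [← hball_adbc]
    exact hadbc.outer_mem_circumballWithVertices P.ad_bc hx y
  · rw [← hball_adbc, ← circumballWithVertices_symm]
    exact hadbc.symm.outer_mem_circumballWithVertices P.ad_bc.symm hx y

theorem image_vertices_eq {s : Set E3} (hvs : {a, b, c, d} ⊆ s)
    (hs : s ⊆ circumballWithVertices a b c d) (g : E3 ≃ᵢ E3)
    (hg : g '' convexHull ℝ s = convexHull ℝ s) : g '' {a, b, c, d} = {a, b, c, d} :=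
  image_eq_of_image_convexHull_eq (Real.sqrt_pos.2 (by norm_num)).ne'
    (midpoint_midpoint_mem_convexHull a b c d) h.vertices_subset_sphere hvs hs g hg

theorem image_tetrahedron_eq_iff (g : E3 ≃ᵢ E3) :
    g '' tetrahedron a b c d = tetrahedron a b c d ↔ g '' {a, b, c, d} = {a, b, c, d} := by
  refine ⟨h.image_vertices_eq subset_rfl subset_union_right g, fun hg => ?_⟩
  have hconv :=
    (g.toRealAffineIsometryEquiv.toAffineEquiv : E3 →ᵃ[ℝ] E3).image_convexHull {a, b, c, d}
  exact hconv.trans (congrArg (convexHull ℝ) hg)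

end IsRegularTetrahedron

namespace IsRobertsBody

variable {a b c d : E3} {R : Set E3} (hR : IsRobertsBody a b c d R)
include hR

theorem image_vertices_eq (h : IsRegularTetrahedron a b c d) (g : E3 ≃ᵢ E3) (hg : g '' R = R) :
    g '' {a, b, c, d} = {a, b, c, d} := by
  obtain ⟨P, rfl⟩ := hR
  exact h.image_vertices_eq P.vertices_subset_surface (h.surface_subset_circumballWithVertices P)
    g hg

theorem image_eq (h : IsRegularTetrahedron a b c d) (g : E3 ≃ᵢ E3)
    (hg : g '' {a, b, c, d} = {a, b, c, d}) : g '' R = R := by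
  have hinj : Function.Injective ![a, b, c, d] := fun i j hij => by
    by_contra hne
    exact two_ne_zero ((h.pairwise_dist_eq hne).symm.trans (dist_eq_zero.2 hij))
  obtain ⟨σ, hσ⟩ := exists_perm_of_image_range_eq hinj g.injective (by rwa [range_vecCons_four])
  have hperm := IsRobertsBody.comp_perm σ ![a, b, c, d] hR
  have hmap := hR.map g.toRealAffineIsometryEquiv
  rw [hσ, hσ, hσ, hσ] at hperm
  exact (h.map g.toRealAffineIsometryEquiv).existsUnique_isRobertsBody.unique hmap hperm

theorem image_eq_iff (h : IsRegularTetrahedron a b c d) (g : E3 ≃ᵢ E3) :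
    g '' R = R ↔ g '' {a, b, c, d} = {a, b, c, d} :=
  ⟨hR.image_vertices_eq h g, hR.image_eq h g⟩

end IsRobertsBody

end Peabody

end

theorem mainTheorem5 (a b c d : Peabody.E3) (habcd : Peabody.IsRegularTetrahedron a b c d) :
    (∃! S : Peabody.ParabolicPeaPod a b × Peabody.ParabolicPeaPod c d,
      Peabody.IsConvexConfocal S.1 S.2) ∧
    (∃! R : Set Peabody.E3, Peabody.IsRobertsBody a b c d R) ∧
    (∀ R : Set Peabody.E3, Peabody.IsRobertsBody a b c d R →
      ∀ g : Peabody.E3 ≃ᵢ Peabody.E3,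
        g '' R = R ↔
          g '' Peabody.tetrahedron a b c d = Peabody.tetrahedron a b c d) :=
  ⟨habcd.existsUnique_isConvexConfocal, habcd.existsUnique_isRobertsBody,
    fun _ hR g => (hR.image_eq_iff habcd g).trans (habcd.image_tetrahedron_eq_iff g).symm⟩
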